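/- For a finite graph $H$ on $h\ge 1$ vertices and real numbers $\varepsilon>0$, $\gamma\in[0,1]$, let $\delta(\varepsilon,H;\gamma)$ be the maximum $\delta\in[0,1]$ such that, for every $n$, every $n$-vertex graph with minimum degree at least $\gamma n$ and with fewer than $\delta n^{h}$ copies of $H$ (subgraphs isomorphic to $H$) can be made $H$-free by deleting at most $\varepsilon n^2$ edges. The \emph{polynomial removal threshold} of $H$ is \[ \delta_{\mathrm{poly\text{-}rem}}(H)=\inf\{\gamma\in[0,1] : \text{there exists } \mu>0 \text{ such that } \delta(\varepsilon,H;\gamma)\ge \mu\,\varepsilon^{1/\mu} \text{ for all } \varepsilon\in(0,1)\}. \] Theorem. For every positive integer $k$, the cycle $C_{2k+1}$ on $2k+1$ vertices satisfies \[ \delta_{\mathrm{poly\text{-}rem}}(C_{2k+1})\ge \frac{1}{2k+1}. \] -/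

import Mathlib

open scoped Classical in
/-- `δ` is admissible for `(ε, H; γ)`: every `n`-vertex graph with minimum degree at least `γ n` and
fewer than `δ n ^ |V(H)|` copies of `H` (subgraphs isomorphic to `H`) can be made `H`-free by
deleting at most `ε n ^ 2` edges. -/
def RemovalAdmissible {W : Type*} [Fintype W] (H : SimpleGraph W) (ε γ δ : ℝ) : Prop :=
  ∀ (n : ℕ) (G : SimpleGraph (Fin n)),
    γ * (n : ℝ) ≤ (G.minDegree : ℝ) →
    (G.copyCount H : ℝ) < δ * (n : ℝ) ^ Fintype.card W →
    ∃ S : Finset (Sym2 (Fin n)), (S : Set (Sym2 (Fin n))) ⊆ G.edgeSet ∧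
      (S.card : ℝ) ≤ ε * (n : ℝ) ^ 2 ∧
      H.Free (G.deleteEdges (S : Set (Sym2 (Fin n))))

/-- The minimum-degree removal function `δ(ε, H; γ)`: the maximum admissible `δ ∈ [0, 1]`
(the supremum is attained, see `isGreatest_removalDelta`). -/
noncomputable def removalDelta {W : Type*} [Fintype W] (H : SimpleGraph W) (ε γ : ℝ) : ℝ :=
  sSup {δ : ℝ | δ ∈ Set.Icc (0 : ℝ) 1 ∧ RemovalAdmissible H ε γ δ}

/-- The supremum defining `removalDelta` is a maximum. -/
theorem isGreatest_removalDelta {W : Type*} [Fintype W] (H : SimpleGraph W) (ε γ : ℝ) :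
    IsGreatest {δ : ℝ | δ ∈ Set.Icc (0 : ℝ) 1 ∧ RemovalAdmissible H ε γ δ}
      (removalDelta H ε γ) := by
  have hne : {δ : ℝ | δ ∈ Set.Icc (0 : ℝ) 1 ∧ RemovalAdmissible H ε γ δ}.Nonempty := by
    refine ⟨0, by simp, fun n G _ h => ?_⟩
    rw [zero_mul] at h
    exact absurd h (not_lt.mpr (Nat.cast_nonneg _))
  have hbd : BddAbove {δ : ℝ | δ ∈ Set.Icc (0 : ℝ) 1 ∧ RemovalAdmissible H ε γ δ} :=
    ⟨1, fun δ hδ => hδ.1.2⟩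
  refine ⟨⟨⟨?_, csSup_le hne fun δ hδ => hδ.1.2⟩, ?_⟩, fun δ hδ => le_csSup hbd hδ⟩
  · obtain ⟨δ, hδ⟩ := hne
    exact hδ.1.1.trans (le_csSup hbd hδ)
  · intro n G hdeg hcop
    have hpos : 0 < (n : ℝ) ^ Fintype.card W := by
      rcases (pow_nonneg (Nat.cast_nonneg n) _ : 0 ≤ (n : ℝ) ^ Fintype.card W).eq_or_lt with h | h
      · rw [← h, mul_zero] at hcop
        exact absurd hcop (not_lt.mpr (Nat.cast_nonneg _))
      · exact h
    obtain ⟨δ, hδ, hlt⟩ := exists_lt_of_lt_csSup hne ((div_lt_iff₀ hpos).mpr hcop)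
    exact hδ.2 n G hdeg ((div_lt_iff₀ hpos).mp hlt)

/-- The polynomial removal threshold of `H`. The set always contains `γ = 1` when `H` has a vertex
(see `one_mem_polyRem_set`), so this is a genuine infimum. -/
noncomputable def polyRem {W : Type*} [Fintype W] (H : SimpleGraph W) : ℝ :=
  sInf {γ : ℝ | γ ∈ Set.Icc (0 : ℝ) 1 ∧
    ∃ μ : ℝ, 0 < μ ∧ ∀ ε ∈ Set.Ioo (0 : ℝ) 1, μ * ε ^ (1 / μ) ≤ removalDelta H ε γ}

/-- The set whose infimum is `polyRem H` is nonempty. -/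
theorem one_mem_polyRem_set {W : Type*} [Fintype W] [Nonempty W] (H : SimpleGraph W) :
    (1 : ℝ) ∈ {γ : ℝ | γ ∈ Set.Icc (0 : ℝ) 1 ∧
      ∃ μ : ℝ, 0 < μ ∧ ∀ ε ∈ Set.Ioo (0 : ℝ) 1, μ * ε ^ (1 / μ) ≤ removalDelta H ε γ} := by
  refine ⟨by simp, 1, one_pos, fun ε hε => ?_⟩
  have h1 : (1 : ℝ) ≤ removalDelta H ε 1 := by
    refine (isGreatest_removalDelta H ε 1).2 ⟨by simp, fun n G hdeg hcop => ?_⟩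
    exfalso
    rcases Nat.eq_zero_or_pos n with rfl | hn
    · rw [Nat.cast_zero, zero_pow Fintype.card_ne_zero, mul_zero] at hcop
      exact absurd hcop (not_lt.mpr (Nat.cast_nonneg _))
    · classical
      have hd : n ≤ G.minDegree := by
        rw [one_mul] at hdeg
        convert (Nat.cast_le (α := ℝ)).mp hdeg
      have h2 := G.minDegree_le_degree ⟨0, hn⟩
      have h3 := G.degree_lt_card_verts ⟨0, hn⟩
      rw [Fintype.card_fin] at h3
      omega
  have := hε.2
  simp only [div_one, Real.rpow_one, one_mul]
  linarith

/-!
Fix an odd `N` and `γ < 1 / N`. A Behrend-type set yields `m ^ (2 - o(1))` edge-disjoint closed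
walks once around a cycle of `N` layers of size `m`, such that their edges form no other closed walk
of this kind. To raise the minimum degree to nearly a `1 / N` fraction of the vertices, join each
layer to a layer of its own in a blow-up of the path on `N` vertices. Edges then either move between
consecutive layers on one side, or switch sides without moving. A closed `N`-walk switches sides an
even number of times, hence moves an odd number of times, and its total displacement is a multiple
of `N`: it goes once around, and it does not use the path, which does not close up. So there are
only `O(m ^ 2)` copies of the `N`-cycle, a proportion `O(1 / m)`, but destroying them all takes
`m ^ (2 - o(1))` edge deletions, a proportion `ε = m ^ (-o(1))`.
-/

theorem labelledCopyCount_eq_natCard {V W : Type*} [Fintype V] [Fintype W] (G : SimpleGraph V)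
    (H : SimpleGraph W) : G.labelledCopyCount H = Nat.card (H.Copy G) := by
  classical
  rw [SimpleGraph.labelledCopyCount, Nat.card_eq_fintype_card]

theorem RemovalAdmissible.exists_free_deleteEdges {V W : Type*} [Fintype V] [Fintype W]
    {H : SimpleGraph W} {ε γ δ : ℝ} (h : RemovalAdmissible H ε γ δ) (G : SimpleGraph V)
    [DecidableRel G.Adj] (hdeg : γ * Fintype.card V ≤ G.minDegree)
    (hcopies : (G.labelledCopyCount H : ℝ) < δ * (Fintype.card V : ℝ) ^ Fintype.card W) :
    ∃ S : Finset (Sym2 V), (S.card : ℝ) ≤ ε * (Fintype.card V : ℝ) ^ 2 ∧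
      H.Free (G.deleteEdges (S : Set (Sym2 V))) := by
  classical
  let e : Fin (Fintype.card V) ≃ V := (Fintype.equivFin V).symm
  let φ : G.comap e ≃g G := SimpleGraph.Iso.comap e G
  have hcount : (G.comap e).copyCount H ≤ G.labelledCopyCount H := by
    refine SimpleGraph.copyCount_le_labelledCopyCount.trans ?_
    rw [labelledCopyCount_eq_natCard, labelledCopyCount_eq_natCard]
    refine Nat.card_le_card_of_injective φ.toCopy.comp fun f g hfg => ?_
    ext u : 1
    exact e.injective (DFunLike.congr_fun hfg u)
  obtain ⟨S, -, hS, hfree⟩ := h _ (G.comap e) (by convert hdeg using 2; convert φ.minDegree_eq)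
    (hcopies.trans_le' (by exact_mod_cast hcount))
  refine ⟨S.image (Sym2.map e), hS.trans' (by exact_mod_cast Finset.card_image_le),
    fun ⟨f⟩ => hfree ?_⟩
  let ψ : G.deleteEdges (S.image (Sym2.map e) : Set (Sym2 V)) →g (G.comap e).deleteEdges S :=
    ⟨e.symm, fun {u v} huv => by
      rw [SimpleGraph.deleteEdges_adj] at huv ⊢
      refine ⟨by simpa using huv.1, fun hmem => huv.2 ?_⟩
      simpa using Set.mem_image_of_mem (Sym2.map e) hmem⟩
  exact ⟨(ψ.toCopy e.symm.injective).comp f⟩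

section ZMod

variable {N : ℕ}

theorem zmod_two_ne_zero_of_odd [Nontrivial (ZMod N)] (hN : Odd N) : (2 : ZMod N) ≠ 0 := by
  obtain ⟨k, rfl⟩ := hN
  intro h
  have hcast : ((2 * k + 1 : ℕ) : ZMod (2 * k + 1)) = 0 := ZMod.natCast_self _
  push_cast at hcast
  exact one_ne_zero (α := ZMod (2 * k + 1)) (by linear_combination hcast - k * h)

theorem zmod_induction [NeZero N] {p : ZMod N → Prop} (h₀ : p 0) (h : ∀ i, p i → p (i + 1))
    (i : ZMod N) : p i := by
  suffices ∀ n : ℕ, p n by simpa using this i.val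
  intro n
  induction n with
  | zero => simpa using h₀
  | succ n ih => simpa using h n ih

theorem sum_zmod_add_one [NeZero N] {M : Type*} [AddCommMonoid M] (φ : ZMod N → M) :
    ∑ i, φ (i + 1) = ∑ i, φ i :=
  Equiv.sum_comp (Equiv.addRight (1 : ZMod N)) φ

theorem forall_eq_one_or_forall_eq_neg_one_of_odd_sum [NeZero N] {e : ZMod N → ℤ}
    (he : ∀ j, |e j| ≤ 1) (hodd : Odd (∑ j, e j)) (hdvd : (N : ℤ) ∣ ∑ j, e j) :
    (∀ j, e j = 1) ∨ (∀ j, e j = -1) := by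
  have hcard : ∑ _j : ZMod N, (1 : ℤ) = N := by simp [ZMod.card]
  have hne : ∑ j, e j ≠ 0 := fun h => by simp [h] at hodd
  have habs : (N : ℤ) ≤ |∑ j, e j| := Int.le_of_dvd (abs_pos.2 hne) ((dvd_abs _ _).2 hdvd)
  have eq_one : ∀ e' : ZMod N → ℤ, (∀ j, e' j ≤ 1) → (N : ℤ) ≤ ∑ j, e' j → ∀ j, e' j = 1 := by
    intro e' hle hsum j
    exact (Finset.sum_eq_sum_iff_of_le fun i _ => hle i).1
      (le_antisymm (Finset.sum_le_sum fun i _ => hle i) (hcard.trans_le hsum)) j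
      (Finset.mem_univ j)
  rcases le_abs.1 habs with h | h
  · exact .inl (eq_one e (fun j => (abs_le.1 (he j)).2) h)
  · refine .inr fun j => neg_eq_iff_eq_neg.1 (eq_one (fun i => -e i) (fun i => ?_) ?_ j)
    · exact neg_le.1 (abs_le.1 (he i)).1
    · rwa [Finset.sum_neg_distrib]

end ZMod

section CycleGraph

variable {N : ℕ} [NeZero N] [Nontrivial (ZMod N)]

theorem cycleGraph_adj_iff_finEquiv {u v : Fin N} :
    (SimpleGraph.cycleGraph N).Adj u v ↔
      ZMod.finEquiv N u = ZMod.finEquiv N v + 1 ∨ ZMod.finEquiv N v = ZMod.finEquiv N u + 1 := by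
  have sub_eq_one : ∀ a b : Fin N, (a - b).val = 1 ↔
      ZMod.finEquiv N a = ZMod.finEquiv N b + 1 := fun a b => by
    have hval : (ZMod.finEquiv N (a - b)).val = (a - b).val := by
      obtain ⟨n, rfl⟩ := Nat.exists_eq_succ_of_ne_zero (NeZero.ne N)
      rfl
    rw [← hval, ← ZMod.val_one'' (ZMod.nontrivial_iff.1 ‹Nontrivial (ZMod N)›),
      (ZMod.val_injective N).eq_iff, map_sub, sub_eq_iff_eq_add']
  rw [SimpleGraph.cycleGraph_adj', sub_eq_one, sub_eq_one]

theorem cycleGraph_adj_finEquiv_symm (j : ZMod N) :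
    (SimpleGraph.cycleGraph N).Adj ((ZMod.finEquiv N).symm j) ((ZMod.finEquiv N).symm (j + 1)) := by
  simp [cycleGraph_adj_iff_finEquiv]

theorem cycleGraph_isContained_of_closedWalk {V : Type*} {G : SimpleGraph V} {f : ZMod N → V}
    (hf : Function.Injective f) (hadj : ∀ i, G.Adj (f i) (f (i + 1))) :
    (SimpleGraph.cycleGraph N).IsContained G := by
  refine ⟨⟨⟨fun u => f (ZMod.finEquiv N u), fun {u v} huv => ?_⟩,
    hf.comp (ZMod.finEquiv N).injective⟩⟩
  rcases cycleGraph_adj_iff_finEquiv.1 huv with h | h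
  · rw [h]
    exact (hadj _).symm
  · rw [h]
    exact hadj _

end CycleGraph

/-- A family of closed walks `P t : ZMod N → X` through `N` disjoint copies of `X`, one vertex in
each copy, is rigid if a closed walk assembled from edges of members, the edge between the copies
`i` and `i + 1` coming from the member `τ i`, is always itself a member. -/
def IsRigidFamily {N : ℕ} {T X : Type*} (P : T → ZMod N → X) : Prop :=
  ∀ τ : ZMod N → T, (∀ i, P (τ i) (i + 1) = P (τ (i + 1)) (i + 1)) → ∀ i j, τ i = τ j

/-- The graph on `N` layers `X` followed in the same cyclic positions by `N` layers `Y`. The edges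
between consecutive layers `X` are those of the closed walks `P t`; consecutive layers `Y` are
completely joined, except for the last and the first; and each layer `X` is completely joined to the
layer `Y` in the same position. -/
def layeredGraph {N : ℕ} {T X : Type*} (P : T → ZMod N → X) (Y : Type*) :
    SimpleGraph (ZMod N × (X ⊕ Y)) :=
  SimpleGraph.fromRel fun p q =>
    match p, q with
    | (i, .inl x), (j, .inl y) => j = i + 1 ∧ ∃ t, x = P t i ∧ y = P t j
    | (i, .inl _), (j, .inr _) => i = j
    | (i, .inr _), (j, .inr _) => j = i + 1 ∧ i ≠ -1
    | (_, .inr _), (_, .inl _) => False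

/-- The member `P t` of a family, as a closed walk in the layers `X` of `layeredGraph P Y`. -/
def memberWalk {N : ℕ} {T X : Type*} (P : T → ZMod N → X) (Y : Type*) (t : T) (i : ZMod N) :
    ZMod N × (X ⊕ Y) :=
  (i, .inl (P t i))

section RigidFamily

variable {N : ℕ} {T X Y : Type*} {P : T → ZMod N → X}

theorem IsRigidFamily.comp {T' X' : Type*} (hP : IsRigidFamily P) {f : T' → T} {g : X → X'}
    (hf : Function.Injective f) (hg : Function.Injective g) :
    IsRigidFamily fun t i => g (P (f t) i) :=
  fun τ hτ i j => hf (hP (f ∘ τ) (fun i => hg (hτ i)) i j)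

variable [Nontrivial (ZMod N)]

theorem IsRigidFamily.eq_of_edge_eq (hP : IsRigidFamily P) {t t' : T} {i : ZMod N}
    (h₀ : P t i = P t' i) (h₁ : P t (i + 1) = P t' (i + 1)) : t = t' := by
  -- replacing the edge of `t` that leaves `i` by that of `t'` yields another closed walk
  have key := hP (fun j => if j = i then t' else t) (fun j => ?_) (i + 1) i
  · simpa using key
  · by_cases hj : j = i
    · subst hj; simp [h₁]
    · by_cases hj' : j + 1 = i
      · simp [hj, hj', h₀]
      · simp [hj, hj']

theorem IsRigidFamily.card_le_card_sq [Fintype T] [Fintype X] (hP : IsRigidFamily P) :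
    Fintype.card T ≤ Fintype.card X ^ 2 := by
  rw [sq, ← Fintype.card_prod]
  refine Fintype.card_le_of_injective (fun t => (P t 0, P t (0 + 1))) fun t t' h => ?_
  exact hP.eq_of_edge_eq (Prod.ext_iff.1 h).1 (Prod.ext_iff.1 h).2

theorem IsRigidFamily.eq_of_memberWalk_edge_eq (hP : IsRigidFamily P) (h2 : (2 : ZMod N) ≠ 0)
    {t t' : T} {i j : ZMod N}
    (h : s(memberWalk P Y t i, memberWalk P Y t (i + 1)) =
      s(memberWalk P Y t' j, memberWalk P Y t' (j + 1))) :
    t = t' := by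
  simp only [memberWalk, Sym2.eq_iff, Prod.mk.injEq, Sum.inl.injEq] at h
  rcases h with ⟨⟨rfl, h₀⟩, -, h₁⟩ | ⟨⟨h₀, -⟩, h₁, -⟩
  · exact hP.eq_of_edge_eq h₀ h₁
  · exact absurd (by linear_combination h₁ - h₀) h2

end RigidFamily

theorem memberWalk_injective {N : ℕ} {T X : Type*} (P : T → ZMod N → X) (Y : Type*) (t : T) :
    Function.Injective (memberWalk P Y t) :=
  fun _ _ h => (Prod.ext_iff.1 h).1

section LayeredGraph

variable {N : ℕ} {T X Y : Type*} {P : T → ZMod N → X}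

theorem layeredGraph_adj_memberWalk [Nontrivial (ZMod N)] (t : T) (i : ZMod N) :
    (layeredGraph P Y).Adj (memberWalk P Y t i) (memberWalk P Y t (i + 1)) := by
  simp only [layeredGraph, memberWalk, SimpleGraph.fromRel_adj]
  exact ⟨by simp, .inl ⟨trivial, t, rfl, rfl⟩⟩

theorem layeredGraph_exists_adj_layer [Nontrivial (ZMod N)] (p : ZMod N × (X ⊕ Y)) :
    ∃ i : ZMod N, ∀ y : Y, (layeredGraph P Y).Adj p (i, .inr y) := by
  obtain ⟨i, x | x⟩ := p
  · exact ⟨i, fun y => by simp [layeredGraph]⟩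
  · by_cases hi : i = -1
    · refine ⟨i - 1, fun y => ?_⟩
      simp [layeredGraph, hi, eq_sub_iff_add_eq]
    · exact ⟨i + 1, fun y => by simp [layeredGraph, hi]⟩

theorem card_le_minDegree_layeredGraph [Fintype X] [Fintype Y] [NeZero N] [Nontrivial (ZMod N)]
    [DecidableRel (layeredGraph P Y).Adj] :
    Fintype.card Y ≤ (layeredGraph P Y).minDegree := by
  cases isEmpty_or_nonempty Y with
  | inl _ => simp
  | inr _ =>
    refine SimpleGraph.le_minDegree_of_forall_le_degree _ _ fun p => ?_
    obtain ⟨i, hi⟩ := layeredGraph_exists_adj_layer (P := P) p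
    rw [← Finset.card_univ, ← SimpleGraph.card_neighborFinset_eq_degree]
    exact Finset.card_le_card_of_injOn (fun y => (i, .inr y)) (fun y _ => by simpa using hi y)
      (fun y _ y' _ h => by simpa using h)

/-- The side of `layeredGraph` on which a vertex lies: `0` for the layers `X`, `1` for the layers
`Y`. -/
def layerSide (p : ZMod N × (X ⊕ Y)) : ZMod 2 :=
  p.2.elim (fun _ => 0) (fun _ => 1)

theorem layeredGraph_adj_step {p q : ZMod N × (X ⊕ Y)} (h : (layeredGraph P Y).Adj p q) :
    ∃ e : ℤ, |e| ≤ 1 ∧ q.1 - p.1 = e ∧ layerSide q - layerSide p = 1 + e := by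
  have two : (1 : ZMod 2) + 1 = 0 := by decide
  have neg_one : (-1 : ZMod 2) = 1 := by decide
  obtain ⟨i, x | x⟩ := p <;> obtain ⟨j, y | y⟩ := q <;>
    simp only [layeredGraph, SimpleGraph.fromRel_adj] at h <;>
    obtain ⟨-, h | h⟩ := h
  · exact ⟨1, by simp, by simp [h.1], by simp [layerSide, two]⟩
  · exact ⟨-1, by simp, by simp [h.1], by simp [layerSide, neg_one, two]⟩
  · exact ⟨0, by simp, by simp [h], by simp [layerSide]⟩
  · exact h.elim
  · exact h.elim
  · exact ⟨0, by simp, by simp [h], by simp [layerSide, neg_one]⟩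
  · exact ⟨1, by simp, by simp [h.1], by simp [layerSide, two]⟩
  · exact ⟨-1, by simp, by simp [h.1], by simp [layerSide, neg_one, two]⟩

theorem layeredGraph_adj_succ [Nontrivial (ZMod N)] (h2 : (2 : ZMod N) ≠ 0) {i : ZMod N}
    {x y : X ⊕ Y} (h : (layeredGraph P Y).Adj (i, x) (i + 1, y)) :
    (∃ t, x = .inl (P t i) ∧ y = .inl (P t (i + 1))) ∨ (i ≠ -1 ∧ x.isRight ∧ y.isRight) := by
  have hne : i ≠ i + 1 + 1 := fun h => h2 (by linear_combination -h)
  rcases x with x | x <;> rcases y with y | y <;>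
    simp only [layeredGraph, SimpleGraph.fromRel_adj] at h <;>
    obtain ⟨-, h | h⟩ := h
  · obtain ⟨-, t, rfl, rfl⟩ := h
    exact .inl ⟨t, rfl, rfl⟩
  · exact absurd h.1 hne
  · simp at h
  · exact h.elim
  · exact h.elim
  · simp at h
  · exact .inr ⟨h.2, rfl, rfl⟩
  · exact absurd h.1 hne

theorem layeredGraph_closedWalk_monotone [NeZero N] (hN : Odd N)
    {f : ZMod N → ZMod N × (X ⊕ Y)} (h : ∀ j, (layeredGraph P Y).Adj (f j) (f (j + 1))) :
    (∀ j, (f (j + 1)).1 = (f j).1 + 1) ∨ (∀ j, (f (j + 1)).1 = (f j).1 - 1) := by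
  choose e he hlayer hside using fun j => layeredGraph_adj_step (h j)
  have hdvd : (N : ℤ) ∣ ∑ j, e j := by
    rw [← ZMod.intCast_zmod_eq_zero_iff_dvd, Int.cast_sum]
    simp only [← hlayer, Finset.sum_sub_distrib, sum_zmod_add_one fun j => (f j).1, sub_self]
  have heven : Even (∑ j, (1 + e j)) := by
    rw [even_iff_two_dvd, ← Nat.cast_two, ← ZMod.intCast_zmod_eq_zero_iff_dvd, Int.cast_sum]
    push_cast
    simp only [← hside, Finset.sum_sub_distrib, sum_zmod_add_one fun j => layerSide (f j),
      sub_self]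
  have hodd : Odd (∑ j, e j) := by
    have hsum : ∑ j, (1 + e j) = N + ∑ j, e j := by simp [Finset.sum_add_distrib, ZMod.card]
    rw [hsum, Int.even_add'] at heven
    exact heven.1 (by exact_mod_cast hN)
  refine (forall_eq_one_or_forall_eq_neg_one_of_odd_sum he hodd hdvd).imp
    (fun hconst j => ?_) fun hconst j => ?_
  · rw [← sub_eq_iff_eq_add', hlayer, hconst, Int.cast_one]
  · rw [sub_eq_add_neg, ← sub_eq_iff_eq_add', hlayer, hconst, Int.cast_neg, Int.cast_one]

variable [NeZero N] [Nontrivial (ZMod N)]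

theorem IsRigidFamily.exists_forall_eq_of_layeredGraph_adj (hP : IsRigidFamily P)
    (h2 : (2 : ZMod N) ≠ 0) {g : ZMod N → X ⊕ Y}
    (h : ∀ i, (layeredGraph P Y).Adj (i, g i) (i + 1, g (i + 1))) :
    ∃ t, ∀ i, g i = .inl (P t i) := by
  have hleft : ∀ i, (g i).isLeft := by
    refine zmod_induction ?_ fun i hi => ?_
    -- the layers `Y` do not close up, so the edge from layer `-1` to layer `0` joins layers `X`
    · obtain ⟨t, -, ht⟩ := (layeredGraph_adj_succ h2 (h (-1))).resolve_right (by simp)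
      rw [neg_add_cancel] at ht
      simp [ht]
    · rcases layeredGraph_adj_succ h2 (h i) with ⟨t, -, ht⟩ | ⟨-, hr, -⟩
      · simp [ht]
      · simp [← Sum.not_isRight, hr] at hi
  have hedge : ∀ i, ∃ t, g i = .inl (P t i) ∧ g (i + 1) = .inl (P t (i + 1)) := fun i =>
    (layeredGraph_adj_succ h2 (h i)).resolve_right fun ⟨_, hr, _⟩ => by
      simp [← Sum.not_isLeft, hleft i] at hr
  choose τ hτ hτ' using hedge
  have hconst := hP τ fun i => Sum.inl_injective ((hτ' i).symm.trans (hτ (i + 1)))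
  exact ⟨τ 0, fun i => by rw [hτ i, hconst i 0]⟩

theorem IsRigidFamily.exists_eq_memberWalk_add (hP : IsRigidFamily P) (h2 : (2 : ZMod N) ≠ 0)
    {f : ZMod N → ZMod N × (X ⊕ Y)} (h : ∀ j, (layeredGraph P Y).Adj (f j) (f (j + 1)))
    (hup : ∀ j, (f (j + 1)).1 = (f j).1 + 1) :
    ∃ (i : ZMod N) (t : T), ∀ j, f j = memberWalk P Y t (i + j) := by
  have hlayer : ∀ j, (f j).1 = (f 0).1 + j :=
    zmod_induction (by simp) fun j hj => by rw [hup, hj, add_assoc]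
  have hpair : ∀ i, f (i - (f 0).1) = (i, (f (i - (f 0).1)).2) := fun i =>
    Prod.ext (by rw [hlayer, add_sub_cancel]) rfl
  obtain ⟨t, ht⟩ := hP.exists_forall_eq_of_layeredGraph_adj (Y := Y) h2
    (g := fun i => (f (i - (f 0).1)).2) fun i => by
      rw [← hpair, ← hpair, add_sub_right_comm]
      exact h _
  refine ⟨(f 0).1, t, fun j => Prod.ext (hlayer j) ?_⟩
  simpa [memberWalk] using ht ((f 0).1 + j)

theorem IsRigidFamily.exists_eq_memberWalk (hP : IsRigidFamily P) (hN : Odd N)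
    {f : ZMod N → ZMod N × (X ⊕ Y)} (h : ∀ j, (layeredGraph P Y).Adj (f j) (f (j + 1))) :
    ∃ (σ : ℤˣ) (i : ZMod N) (t : T), ∀ j, f j = memberWalk P Y t (i + (σ : ℤ) * j) := by
  have h2 := zmod_two_ne_zero_of_odd hN
  rcases layeredGraph_closedWalk_monotone hN h with hup | hdown
  · obtain ⟨i, t, hf⟩ := hP.exists_eq_memberWalk_add h2 h hup
    exact ⟨1, i, t, by simpa using hf⟩
  · have hrev : ∀ j : ZMod N, -(j + 1) + 1 = -j := fun j => by ring
    obtain ⟨i, t, hf⟩ := hP.exists_eq_memberWalk_add h2 (f := fun j => f (-j))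
      (fun j => hrev j ▸ (h (-(j + 1))).symm)
      (fun j => by rw [← hrev j, hdown, sub_add_cancel])
    exact ⟨-1, i, t, fun j => by simpa using hf (-j)⟩

theorem IsRigidFamily.labelledCopyCount_cycleGraph_le [Fintype T] [Fintype X] [Fintype Y]
    (hP : IsRigidFamily P) (hN : Odd N) :
    (layeredGraph P Y).labelledCopyCount (SimpleGraph.cycleGraph N) ≤
      2 * N * Fintype.card T := by
  classical
  have hex : ∀ f : (SimpleGraph.cycleGraph N).Copy (layeredGraph P Y),
      ∃ c : ℤˣ × ZMod N × T, ∀ u, f u =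
        memberWalk P Y c.2.2 (c.2.1 + (c.1 : ℤ) * ZMod.finEquiv N u) := by
    intro f
    obtain ⟨σ, i, t, h⟩ := hP.exists_eq_memberWalk hN (f := fun j => f ((ZMod.finEquiv N).symm j))
      fun j => f.toHom.map_adj (cycleGraph_adj_finEquiv_symm j)
    exact ⟨(σ, i, t), fun u => by simpa using h (ZMod.finEquiv N u)⟩
  choose c hc using hex
  have hinj : Function.Injective c := fun f g hfg => by
    ext u : 1
    rw [hc f, hc g, hfg]
  calc (layeredGraph P Y).labelledCopyCount (SimpleGraph.cycleGraph N)
      = Nat.card ((SimpleGraph.cycleGraph N).Copy (layeredGraph P Y)) :=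
        labelledCopyCount_eq_natCard _ _
    _ ≤ Nat.card (ℤˣ × ZMod N × T) := Nat.card_le_card_of_injective c hinj
    _ = 2 * N * Fintype.card T := by simp [ZMod.card, mul_assoc]

theorem IsRigidFamily.card_le_of_free_deleteEdges [Fintype T] (hP : IsRigidFamily P)
    (h2 : (2 : ZMod N) ≠ 0) {S : Finset (Sym2 (ZMod N × (X ⊕ Y)))}
    (hS : (SimpleGraph.cycleGraph N).Free ((layeredGraph P Y).deleteEdges S)) :
    Fintype.card T ≤ S.card := by
  have hmeet : ∀ t, ∃ i, s(memberWalk P Y t i, memberWalk P Y t (i + 1)) ∈ S := by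
    intro t
    by_contra! hdisj
    refine hS (cycleGraph_isContained_of_closedWalk (memberWalk_injective P Y t) fun i => ?_)
    exact SimpleGraph.deleteEdges_adj.2 ⟨layeredGraph_adj_memberWalk t i, hdisj i⟩
  choose i hi using hmeet
  rw [← Finset.card_univ]
  exact Finset.card_le_card_of_injOn _ (fun t _ => hi t)
    fun t _ t' _ h => hP.eq_of_memberWalk_edge_eq h2 h

theorem IsRigidFamily.removalDelta_mul_pow_le [Fintype T] [Fintype X] [Fintype Y]
    (hP : IsRigidFamily P) (hN : Odd N) {n : ℕ}
    (hn : n = N * (Fintype.card X + Fintype.card Y)) {ε γ : ℝ}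
    (hγ : γ * n ≤ Fintype.card Y) (hε : ε * n ^ 2 < Fintype.card T) :
    removalDelta (SimpleGraph.cycleGraph N) ε γ * n ^ N ≤ 2 * N * Fintype.card T := by
  classical
  have hcard : Fintype.card (ZMod N × (X ⊕ Y)) = n := by simp [ZMod.card, hn]
  by_contra! hδ
  obtain ⟨S, hS, hfree⟩ :=
    (isGreatest_removalDelta (SimpleGraph.cycleGraph N) ε γ).1.2.exists_free_deleteEdges
      (layeredGraph P Y)
      (by rw [hcard]; exact hγ.trans (by exact_mod_cast card_le_minDegree_layeredGraph))
      (by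
        rw [hcard, Fintype.card_fin]
        exact hδ.trans_le' (by exact_mod_cast hP.labelledCopyCount_cycleGraph_le hN))
  have hT := hP.card_le_of_free_deleteEdges (zmod_two_ne_zero_of_odd hN) hfree
  rw [hcard] at hS
  exact absurd (hS.trans_lt hε) (not_lt.2 (by exact_mod_cast hT))

end LayeredGraph

theorem eq_of_norm_eq_of_sum_eq_card_nsmul {ι E : Type*} [Fintype ι] [NormedAddCommGroup E]
    [InnerProductSpace ℝ E] {v : ι → E} {a : ι} (hnorm : ∀ i, ‖v i‖ = ‖v a‖)
    (hsum : ∑ i, v i = Fintype.card ι • v a) (i : ι) : v i = v a := by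
  have hdist : ∑ i, ‖v i - v a‖ ^ 2 = 0 := by
    calc ∑ i, ‖v i - v a‖ ^ 2
        = ∑ i, (2 * ‖v a‖ ^ 2 - 2 * inner ℝ (v i) (v a)) :=
          Finset.sum_congr rfl fun i _ => by rw [norm_sub_sq_real, hnorm]; ring
      _ = Fintype.card ι * (2 * ‖v a‖ ^ 2) - 2 * inner ℝ (∑ i, v i) (v a) := by
          simp [Finset.sum_sub_distrib, ← Finset.mul_sum, sum_inner]
      _ = 0 := by
          rw [hsum, ← Nat.cast_smul_eq_nsmul ℝ, real_inner_smul_left, real_inner_self_eq_norm_sq]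
          ring
  have hzero := (Finset.sum_eq_zero_iff_of_nonneg fun _ _ => sq_nonneg _).1 hdist i
    (Finset.mem_univ i)
  exact sub_eq_zero.1 (norm_eq_zero.1 (pow_eq_zero_iff two_ne_zero |>.1 hzero))

theorem eq_of_mem_behrendSphere_of_sum_eq_card_mul {ι : Type*} [Fintype ι] {D d R : ℕ}
    {s : ι → Fin D → ℕ} (hs : ∀ i, s i ∈ Behrend.sphere D d R) {a : ι}
    (hsum : ∀ c, ∑ i, s i c = Fintype.card ι * s a c) (i : ι) : s i = s a := by
  let v : ι → EuclideanSpace ℝ (Fin D) := fun i => WithLp.toLp 2 ((↑) ∘ s i)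
  have hv : v i = v a := by
    refine eq_of_norm_eq_of_sum_eq_card_nsmul (fun j => ?_) ?_ i
    · rw [Behrend.norm_of_mem_sphere (hs j), Behrend.norm_of_mem_sphere (hs a)]
    · ext c
      simpa [v] using congrArg (Nat.cast (R := ℝ)) (hsum c)
  funext c
  simpa [v] using congrArg (fun w : EuclideanSpace ℝ (Fin D) => w c) hv

/-- The arithmetic progressions `x, x + s, …, x + (N - 1) s` in `(ZMod M) ^ D` with `s ∈ S`, read
as closed walks of length `N`. -/
def progressionFamily (N M : ℕ) {D : ℕ} (S : Finset (Fin D → ℕ)) :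
    (Fin D → ZMod M) × S → ZMod N → Fin D → ZMod M :=
  fun p i c => p.1 c + i.cast * (p.2.1 c : ZMod M)

theorem progressionFamily_add_one_sub {N M D : ℕ} {S : Finset (Fin D → ℕ)}
    (p : (Fin D → ZMod M) × S) (i : ZMod N) (c : Fin D) :
    progressionFamily N M S p (i + 1) c - progressionFamily N M S p i c =
      p.2.1 c - if i = -1 then (N : ZMod M) * p.2.1 c else 0 := by
  have hcast := ZMod.cast_sub_one (R := ZMod M) (i + 1)
  simp only [add_sub_cancel_right, ← eq_neg_iff_add_eq_zero] at hcast
  simp only [progressionFamily]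
  split_ifs at hcast ⊢ with hi
  · rw [hcast, hi, neg_add_cancel, ZMod.cast_zero]
    ring
  · rw [hcast]
    ring

theorem pow_rpow_two_sub_le_mul {N D d s : ℕ} {α : ℝ} (hN : 0 < N) (hd : 0 < d)
    (hDα : 3 ≤ D * α) (hdN : D * N ^ D ≤ d)
    (hs : ((d ^ D : ℕ) / (D * d ^ 2 : ℕ) : ℝ) ≤ s) :
    (((N * d) ^ D : ℕ) : ℝ) ^ (2 - α) ≤ ((N * d) ^ D * s : ℕ) := by
  have hD0 : (0 : ℝ) < D := by
    refine lt_of_le_of_ne D.cast_nonneg fun h => ?_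
    rw [← h] at hDα
    linarith
  have hα : 0 < α := pos_of_mul_pos_right (zero_lt_three.trans_le hDα) hD0.le
  have hd1 : (1 : ℝ) ≤ d := by exact_mod_cast hd
  have hN1 : (1 : ℝ) ≤ N := by exact_mod_cast hN
  have hdN' : (D : ℝ) * N ^ D ≤ d := by exact_mod_cast hdN
  push_cast at hs ⊢
  set m : ℝ := (N * d) ^ D with hm
  have hm0 : 0 < m := by positivity
  have hcube : (d : ℝ) ^ 3 ≤ m ^ α := by
    calc (d : ℝ) ^ 3 = (d : ℝ) ^ (3 : ℝ) := by norm_cast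
      _ ≤ (d : ℝ) ^ (D * α) := Real.rpow_le_rpow_of_exponent_le hd1 hDα
      _ = ((d : ℝ) ^ D) ^ α := Real.rpow_natCast_mul (by positivity) D α
      _ ≤ m ^ α := by
        rw [hm]
        gcongr
        exact le_mul_of_one_le_left (by positivity) hN1
  have hms : m ≤ s * m ^ α := by
    calc m = N ^ D * d ^ D := mul_pow _ _ _
      _ ≤ N ^ D * (s * (D * d ^ 2)) := by
        gcongr
        exact (div_le_iff₀ (by positivity)).1 hs
      _ = s * (D * N ^ D * d ^ 2) := by ring
      _ ≤ s * (d * d ^ 2) := by gcongr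
      _ = s * d ^ 3 := by ring
      _ ≤ s * m ^ α := by gcongr
  rw [Real.rpow_sub hm0, div_le_iff₀ (by positivity), Real.rpow_two, sq, mul_assoc]
  gcongr

section ProgressionFamily

variable {N : ℕ} [NeZero N]

theorem sum_step_eq_of_progressionFamily_chain {M D : ℕ} {S : Finset (Fin D → ℕ)}
    {τ : ZMod N → (Fin D → ZMod M) × S}
    (hτ : ∀ i, progressionFamily N M S (τ i) (i + 1) =
      progressionFamily N M S (τ (i + 1)) (i + 1)) (c : Fin D) :
    ∑ i, ((τ i).2.1 c : ZMod M) = N * (τ (-1)).2.1 c := by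
  have hclosed : ∑ i, (progressionFamily N M S (τ i) (i + 1) c -
      progressionFamily N M S (τ i) i c) = 0 := by
    simp only [hτ, Finset.sum_sub_distrib,
      sum_zmod_add_one fun i => progressionFamily N M S (τ i) i c, sub_self]
  simpa [progressionFamily_add_one_sub, sub_eq_zero] using hclosed

theorem isRigidFamily_progressionFamily_behrendSphere (D d R : ℕ) :
    IsRigidFamily (progressionFamily N (N * d) (Behrend.sphere D d R)) := by
  intro τ hτ
  have hlt : ∀ i c, (τ i).2.1 c < d := fun i c =>
    Behrend.mem_box.1 (Behrend.sphere_subset_box (τ i).2.2) c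
  -- both sides are less than the modulus `N * d`, so the steps already add up in `ℕ`
  have hsum : ∀ c, ∑ i, (τ i).2.1 c = Fintype.card (ZMod N) * (τ (-1)).2.1 c := by
    intro c
    have hmod : ((∑ i, (τ i).2.1 c : ℕ) : ZMod (N * d)) = (N * (τ (-1)).2.1 c : ℕ) := by
      exact_mod_cast sum_step_eq_of_progressionFamily_chain hτ c
    have hsum_lt : ∑ i, (τ i).2.1 c < N * d := by
      calc ∑ i, (τ i).2.1 c < ∑ _i : ZMod N, d :=
            Finset.sum_lt_sum_of_nonempty Finset.univ_nonempty fun i _ => hlt i c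
        _ = N * d := by simp [ZMod.card]
    rw [ZMod.card]
    exact Nat.ModEq.eq_of_lt_of_lt ((ZMod.natCast_eq_natCast_iff _ _ _).1 hmod) hsum_lt
      (Nat.mul_lt_mul_of_pos_left (hlt _ c) (NeZero.pos N))
  have hstep : ∀ i, (τ i).2 = (τ (-1)).2 := fun i =>
    Subtype.ext (eq_of_mem_behrendSphere_of_sum_eq_card_mul (fun i => (τ i).2.2) hsum i)
  have hsucc : ∀ i, τ (i + 1) = τ i := by
    intro i
    refine Prod.ext (funext fun c => ?_) ((hstep (i + 1)).trans (hstep i).symm)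
    have hc := congrFun (hτ i) c
    simp only [progressionFamily, hstep] at hc
    exact (add_right_cancel hc).symm
  have hconst : ∀ i, τ i = τ 0 := zmod_induction rfl fun i hi => (hsucc i).trans hi
  exact fun i j => (hconst i).trans (hconst j).symm

theorem exists_isRigidFamily_rpow_le {α : ℝ} (hα : 0 < α) (m₀ : ℕ) :
    ∃ m ≥ m₀, ∃ (t : ℕ) (P : Fin t → ZMod N → Fin m),
      IsRigidFamily P ∧ (m : ℝ) ^ (2 - α) ≤ t := by
  obtain ⟨D, hD⟩ := exists_nat_ge (3 / α)
  have hDα : 3 ≤ D * α := (div_le_iff₀ hα).1 hD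
  have hD0 : D ≠ 0 := by
    rintro rfl
    norm_num at hDα
  let d := max (D * N ^ D) (max 1 m₀)
  have hd1 : 1 ≤ d := (le_max_left 1 m₀).trans (le_max_right _ _)
  have hdN : D * N ^ D ≤ d := le_max_left _ _
  obtain ⟨R, hR⟩ := Behrend.exists_large_sphere D d
  have : NeZero (N * d) := ⟨(Nat.mul_pos (NeZero.pos N) hd1).ne'⟩
  have hX : Fintype.card (Fin D → ZMod (N * d)) = (N * d) ^ D := by simp [ZMod.card]
  have hT : Fintype.card ((Fin D → ZMod (N * d)) × Behrend.sphere D d R) =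
      (N * d) ^ D * (Behrend.sphere D d R).card := by simp [ZMod.card]
  have hdm : d ≤ (N * d) ^ D :=
    (Nat.le_mul_of_pos_left d (NeZero.pos N)).trans (Nat.le_self_pow hD0 _)
  refine ⟨(N * d) ^ D, hdm.trans' ((le_max_right 1 m₀).trans (le_max_right _ _)), _, _,
    (isRigidFamily_progressionFamily_behrendSphere (N := N) D d R).comp
      (Fintype.equivFinOfCardEq hT).symm.injective (Fintype.equivFinOfCardEq hX).injective, ?_⟩
  exact pow_rpow_two_sub_le_mul (NeZero.pos N) hd1 hDα hdN hR

end ProgressionFamily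

theorem le_rpow_one_div_mul_sqrt {A ε m μ : ℝ} (hA : 0 ≤ A) (hε : 0 ≤ ε) (hm : 0 ≤ m) (hμ : 0 < μ)
    (h : A ≤ ε * m ^ (μ / 2)) : A ^ (1 / μ) ≤ ε ^ (1 / μ) * √m := by
  calc A ^ (1 / μ) ≤ (ε * m ^ (μ / 2)) ^ (1 / μ) := by gcongr
    _ = ε ^ (1 / μ) * √m := by
      rw [Real.mul_rpow hε (by positivity), ← Real.rpow_mul hm, Real.sqrt_eq_rpow]
      congr 2
      field_simp

theorem lt_mul_rpow_one_div_mul {A b ε m μ : ℝ} (hA : 0 < A) (hε : 0 ≤ ε) (hμ : 0 < μ)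
    (h : A ≤ ε * m ^ (μ / 2)) (hm : (b / (μ * A ^ (1 / μ))) ^ 2 < m) :
    b < μ * ε ^ (1 / μ) * m := by
  have hm0 : 0 < m := (sq_nonneg _).trans_lt hm
  calc b < μ * A ^ (1 / μ) * √m := (div_lt_iff₀' (by positivity)).1 (Real.lt_sqrt_of_sq_lt hm)
    _ ≤ μ * (ε ^ (1 / μ) * √m) * √m := by
      gcongr
      exact le_rpow_one_div_mul_sqrt hA.le hε hm0.le hμ h
    _ = μ * ε ^ (1 / μ) * m := by
      rw [← mul_assoc, mul_assoc _ √m, Real.mul_self_sqrt hm0.le]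

theorem exists_nat_mul_succ_le {a : ℝ} (ha : a < 1) : ∃ q : ℕ, a * (q + 1) ≤ q := by
  obtain ⟨q, hq⟩ := exists_nat_ge (a / (1 - a))
  rw [div_le_iff₀ (by linarith)] at hq
  exact ⟨q, by linarith⟩

section RemovalDelta

variable {N : ℕ} [NeZero N] [Nontrivial (ZMod N)]

theorem IsRigidFamily.removalDelta_mul_le {q m t : ℕ} {P : Fin t → ZMod N → Fin m}
    (hP : IsRigidFamily P) (hN : Odd N) (hm : 0 < m) (ht : 0 < t) {γ : ℝ}
    (hγ : γ * N * (q + 1) ≤ q) :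
    removalDelta (SimpleGraph.cycleGraph N) (t / (2 * (N * (q + 1) * m) ^ 2)) γ * m ≤ 2 * N := by
  set δ := removalDelta (SimpleGraph.cycleGraph N) (t / (2 * (N * (q + 1) * m) ^ 2)) γ
  have hδ : 0 ≤ δ := (isGreatest_removalDelta _ _ _).1.1.1
  have hN0 : (0 : ℝ) < N := by exact_mod_cast NeZero.pos N
  have hN3 : 3 ≤ N := by
    have hN1 : N ≠ 1 := ZMod.nontrivial_iff.1 ‹_›
    obtain ⟨k, rfl⟩ := hN
    lia
  have hm0 : (0 : ℝ) < m := by exact_mod_cast hm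
  have ht0 : (0 : ℝ) < t := by exact_mod_cast ht
  have htm : (t : ℝ) ≤ m ^ 2 := by exact_mod_cast (by simpa using hP.card_le_card_sq)
  have hδt : δ * (N * (q + 1) * m) ^ N ≤ 2 * N * t := by
    have key := hP.removalDelta_mul_pow_le (Y := Fin (q * m)) (n := N * (q + 1) * m)
      (ε := t / (2 * (N * (q + 1) * m) ^ 2)) (γ := γ) hN
      (by simp only [Fintype.card_fin]; ring)
      (by
        push_cast [Fintype.card_fin]
        calc γ * (N * (q + 1) * m) = γ * N * (q + 1) * m := by ring
          _ ≤ q * m := by gcongr)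
      (by
        push_cast [Fintype.card_fin]
        rw [← div_div, div_mul_cancel₀ _ (by positivity)]
        exact half_lt_self ht0)
    simpa using key
  refine le_of_mul_le_mul_right ?_ (pow_pos hm0 2)
  calc δ * m * m ^ 2 = δ * m ^ 3 := by ring
    _ ≤ δ * (N * (q + 1) * m) ^ N := by
      gcongr ?_ * ?_
      have hC : 1 ≤ N * (q + 1) := Nat.mul_pos (NeZero.pos N) q.succ_pos
      exact_mod_cast (Nat.pow_le_pow_right hm hN3).trans
        (Nat.pow_le_pow_left (Nat.le_mul_of_pos_left m hC) N)
    _ ≤ 2 * N * t := hδt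
    _ ≤ 2 * N * m ^ 2 := by gcongr

theorem exists_removalDelta_cycleGraph_lt (hN : Odd N) {γ : ℝ} (hγ : γ * N < 1) {μ : ℝ}
    (hμ : 0 < μ) :
    ∃ ε ∈ Set.Ioo (0 : ℝ) 1,
      removalDelta (SimpleGraph.cycleGraph N) ε γ < μ * ε ^ (1 / μ) := by
  have hN1 : (1 : ℝ) ≤ N := by exact_mod_cast NeZero.one_le (n := N)
  obtain ⟨q, hq⟩ := exists_nat_mul_succ_le hγ
  let C : ℝ := N * (q + 1)
  have hC : 1 ≤ C := one_le_mul_of_one_le_of_one_le hN1 (by simp)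
  let A : ℝ := 1 / (2 * C ^ 2)
  have hA : 0 < A := by positivity
  obtain ⟨m₀, hm₀⟩ := exists_nat_gt ((2 * N / (μ * A ^ (1 / μ))) ^ 2)
  obtain ⟨m, hm, t, P, hP, hmt⟩ := exists_isRigidFamily_rpow_le (N := N) (half_pos hμ) m₀
  have hmlarge : (2 * N / (μ * A ^ (1 / μ))) ^ 2 < m := hm₀.trans_le (by exact_mod_cast hm)
  have hm0 : (0 : ℝ) < m := (sq_nonneg _).trans_lt hmlarge
  have ht0 : (0 : ℝ) < t := hmt.trans_lt' (by positivity)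
  have htm : (t : ℝ) ≤ m ^ 2 := by exact_mod_cast (by simpa using hP.card_le_card_sq)
  let ε : ℝ := t / (2 * (C * m) ^ 2)
  have hε0 : 0 < ε := by positivity
  have hε1 : ε < 1 := by
    rw [div_lt_one (by positivity)]
    calc (t : ℝ) ≤ m ^ 2 := htm
      _ ≤ (C * m) ^ 2 := by gcongr; exact le_mul_of_one_le_left hm0.le hC
      _ < 2 * (C * m) ^ 2 := lt_mul_left (by positivity) one_lt_two
  have hAε : A ≤ ε * m ^ (μ / 2) := by
    rw [Real.rpow_sub hm0, Real.rpow_two, div_le_iff₀ (by positivity)] at hmt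
    calc A = m ^ 2 / (2 * (C * m) ^ 2) := by simp only [A]; field_simp
      _ ≤ t * m ^ (μ / 2) / (2 * (C * m) ^ 2) := by gcongr
      _ = ε * m ^ (μ / 2) := by simp only [ε]; ring
  refine ⟨ε, ⟨hε0, hε1⟩, lt_of_mul_lt_mul_right ?_ hm0.le⟩
  exact (hP.removalDelta_mul_le hN (by exact_mod_cast hm0) (by exact_mod_cast ht0) hq).trans_lt
    (lt_mul_rpow_one_div_mul hA hε0.le hμ hAε hmlarge)

end RemovalDelta

theorem theorem4p3 (k : ℕ) (hk : 0 < k) :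
    (1 : ℝ) / (2 * (k : ℝ) + 1) ≤ polyRem (SimpleGraph.cycleGraph (2 * k + 1)) := by
  have : Fact (1 < 2 * k + 1) := ⟨by lia⟩
  refine le_csInf ⟨1, one_mem_polyRem_set _⟩ ?_
  rintro γ ⟨-, μ, hμ, h⟩
  by_contra! hγ
  obtain ⟨ε, hε, hlt⟩ := exists_removalDelta_cycleGraph_lt (N := 2 * k + 1) (γ := γ)
    (odd_two_mul_add_one k) (by push_cast; exact (lt_div_iff₀ (by positivity)).1 hγ) hμ
  exact absurd (h ε hε) (not_le.2 hlt)
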